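/- Let $G=(V,E)$ be a finite ribbon graph, that is, a surface with boundary presented as the union of a finite set $V$ of vertex discs and a finite set $E$ of edge discs, where vertices and edges meet in disjoint line segments, each segment lies on the boundary of exactly one vertex and exactly one edge, and each edge contains exactly two of them. ($G$ may be disconnected, non-orientable, and may have loops, multiple edges and isolated vertices; ribbon graphs are considered up to the usual equivalence.) Each $A\subseteq E$ determines the spanning ribbon subgraph $(V,A)$. Write $v(\cdot)$ and $k(\cdot)$ for the numbers of vertices and of connected components, and let $\gamma(\cdot)$ be the Euler genus: the genus of the closed surface obtained by capping off all boundary components with discs if that surface is connected and non-orientable, twice its genus if it is connected and orientable, extended additively over connected components; equivalently, the dimension of the first homology group of that closed surface with coefficients in $\mathbb{Z}/2\mathbb{Z}$. A spanning quasi-tree of $G$ is a spanning ribbon subgraph $Q$ with $k(Q)=k(G)$ each of whose connected components has exactly one boundary component. Let $D=D(G)=(E,\mathcal F)$, where $\mathcal F$, the collection of feasible sets, consists of the edge sets of the spanning quasi-trees of $G$. Let $D_{\min}$ and $D_{\max}$ be the set systems on $E$ formed by the feasible sets of minimum and of maximum cardinality; their ranks $r(D_{\min})$, $r(D_{\max})$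 are these cardinalities, and the width of $D$ is $w(D)=r(D_{\max})-r(D_{\min})$. $D$ is even if the cardinalities of all its feasible sets have the same parity. Then $D$ is a delta-matroid, i.e. $\mathcal F\neq\emptyset$ and for all $X,Y\in\mathcal F$ and $u\in X\bigtriangleup Y$ there is $v\in X\bigtriangleup Y$ (possibly $v=u$) with $X\bigtriangleup\{u,v\}\in\mathcal F$; moreover: 1. for every integer $m\ge 0$, the map that takes a spanning quasi-tree to its edge set is a bijection from the set of spanning quasi-trees of $G$ of Euler genus $m-v(G)+k(G)$ onto the set of feasible sets of $D$ of cardinality $m$; 2. $r(D_{\min})$ is equal to the number of edges of any maximal spanning forest of $G$, that is, $r(D_{\min})=v(G)-k(G)$; 3. $w(D)=\gamma(G)$; 4. $D$ is even if and only if $G$ is orientable. -/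

import Mathlib

/-! ## Set systems and delta-matroids -/

/-- A set system on a finite ground set `E`: a collection of feasible subsets of `E`. -/
structure SetSystem (E : Type*) where
  /-- the collection of feasible sets -/
  feasible : Set (Finset E)

namespace SetSystem

variable {E : Type*}

/-- A delta-matroid is a set system with at least one feasible set that satisfies the symmetric
exchange axiom (`v = u` is allowed). -/
def IsDeltaMatroid [DecidableEq E] (D : SetSystem E) : Prop :=
  D.feasible.Nonempty ∧
    ∀ X ∈ D.feasible, ∀ Y ∈ D.feasible, ∀ u ∈ symmDiff X Y,
      ∃ v ∈ symmDiff X Y, symmDiff X {u, v} ∈ D.feasible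

/-- `D_min`: the feasible sets are the feasible sets of `D` of minimum cardinality. -/
def lower (D : SetSystem E) : SetSystem E :=
  ⟨{F | F ∈ D.feasible ∧ ∀ F' ∈ D.feasible, F.card ≤ F'.card}⟩

/-- `D_max`: the feasible sets are the feasible sets of `D` of maximum cardinality. -/
def upper (D : SetSystem E) : SetSystem E :=
  ⟨{F | F ∈ D.feasible ∧ ∀ F' ∈ D.feasible, F'.card ≤ F.card}⟩

/-- The rank `r(M) = max {|E ∩ B| : B a basis} = max {|B| : B a basis}` of a matroid given by its
bases. -/
noncomputable def rank (M : SetSystem E) : ℕ :=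
  sSup (Finset.card '' M.feasible)

/-- The width `w(D) = r(D_max) - r(D_min)`. -/
noncomputable def width (D : SetSystem E) : ℤ :=
  (D.upper.rank : ℤ) - (D.lower.rank : ℤ)

/-- All feasible sets have the same parity. -/
def IsEven (D : SetSystem E) : Prop :=
  ∀ F ∈ D.feasible, ∀ F' ∈ D.feasible, (Even F.card ↔ Even F'.card)

end SetSystem

/-! ## Ribbon graphs -/

/-- A ribbon graph with set `V` of vertex discs and set `E` of edge discs, given by the gluing data
of the discs (a signed rotation system).

The edge disc `e` has two attaching line segments, called half-edges, `(e, false)` and `(e, true)`.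
`vert h` is the vertex disc on whose boundary the half-edge `h` lies. Fix an orientation of the
boundary circle of each vertex disc: `rot h` is the half-edge that follows `h` in the resulting
cyclic order, so the cycles of `rot` are the sets of half-edges at the vertices. A vertex without
half-edges is an isolated vertex. Finally, `twisted e` tells whether the band `e` is glued with a
half-twist relative to the chosen orientations of the vertex discs at its two ends. -/
structure RibbonGraph (V E : Type*) where
  /-- the vertex at which a half-edge is attached -/
  vert : E × Bool → V
  /-- the next half-edge in the cyclic order at its vertex -/
  rot : Equiv.Perm (E × Bool)
  /-- whether an edge is twisted -/
  twisted : E → Bool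
  vert_rot : ∀ h, vert (rot h) = vert h
  sameCycle_of_vert_eq : ∀ h h', vert h = vert h' → rot.SameCycle h h'

namespace RibbonGraph

variable {V E : Type*}

/-- A ribbon graph is orientable when regarded as a surface: the vertex discs can be oriented
(`o v = true`: reverse the given orientation of `v`) in such a way that no band is twisted
relative to the new orientations of the discs at its ends. -/
def Orientable (G : RibbonGraph V E) : Prop :=
  ∃ o : V → Bool, ∀ e, G.twisted e = xor (o (G.vert (e, false))) (o (G.vert (e, true)))

/-- The spanning ribbon subgraph `(V, A)` of `G`: all vertex discs, and the edge discs in `A`. -/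
@[ext]
structure SpanningSubgraph (G : RibbonGraph V E) where
  /-- the set `A` of edges that are kept -/
  edges : Finset E

/-- The ribbon graph `G` as a spanning ribbon subgraph of itself. -/
def whole [Fintype E] (G : RibbonGraph V E) : G.SpanningSubgraph := ⟨Finset.univ⟩

namespace SpanningSubgraph

variable {G : RibbonGraph V E}

/-- Adjacency through an edge of the spanning ribbon subgraph. -/
def Joined (Q : G.SpanningSubgraph) (u v : V) : Prop :=
  ∃ e ∈ Q.edges, G.vert (e, false) = u ∧ G.vert (e, true) = v

/-- The connected components of a spanning ribbon subgraph, as classes of vertices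
(`Quot` divides by the equivalence relation that `Joined` generates). -/
def Component (Q : G.SpanningSubgraph) : Type _ := Quot Q.Joined

/-- The number `k(Q)` of connected components. -/
noncomputable def k (Q : G.SpanningSubgraph) : ℕ := Nat.card Q.Component

/-- The end points of the half-edge `h` on the boundary of its vertex disc are the corners
`(h, false)`, met first, and `(h, true)`, met second, in the chosen direction around that disc.
`BoundaryStep Q` relates two corners joined by an arc of the boundary of the surface
`Q = (V, A)`, where the arc contains no other corner. Such an arc is
* a piece of the boundary of a vertex disc between consecutive half-edges,
* one of the two free sides of an edge disc in `A`, or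
* the attaching segment of an edge of `G` not in `A`. -/
inductive BoundaryStep (Q : G.SpanningSubgraph) : (E × Bool) × Bool → (E × Bool) × Bool → Prop
  | arc (h : E × Bool) : BoundaryStep Q (h, true) (G.rot h, false)
  | side (e : E) (he : e ∈ Q.edges) (b s : Bool) :
      BoundaryStep Q ((e, b), s) ((e, !b), xor s (!G.twisted e))
  | segment (e : E) (he : e ∉ Q.edges) (b : Bool) : BoundaryStep Q ((e, b), false) ((e, b), true)

/-- The boundary components of the surface `Q`: those that pass through corners, together with
the whole boundary circle of each vertex disc to which no edge of `G` is attached. -/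
def BoundaryComponent (Q : G.SpanningSubgraph) : Type _ :=
  Quot Q.BoundaryStep ⊕ {v : V // ∀ h, G.vert h ≠ v}

/-- The number `f(Q)` of boundary components. -/
noncomputable def f (Q : G.SpanningSubgraph) : ℕ := Nat.card Q.BoundaryComponent

/-- The connected component on which a boundary component lies. -/
def BoundaryComponent.component {Q : G.SpanningSubgraph} : Q.BoundaryComponent → Q.Component :=
  Sum.elim
    (Quot.lift (fun c => Quot.mk _ (G.vert c.1)) (by
      intro c c' hcc'
      cases hcc' with
      | arc h => rw [G.vert_rot]
      | side e he b s =>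
        cases b
        · exact Quot.sound ⟨e, he, rfl, rfl⟩
        · exact (Quot.sound ⟨e, he, rfl, rfl⟩).symm
      | segment e he b => rfl))
    (fun v => Quot.mk _ v.1)

/-- `Q` is a spanning quasi-tree of `G`: it has as many connected components as `G`, and each of
them has exactly one boundary component. -/
def IsQuasiTree [Fintype E] (Q : G.SpanningSubgraph) : Prop :=
  Q.k = G.whole.k ∧ ∀ c : Q.Component, ∃! b : Q.BoundaryComponent, b.component = c

/-- A forest: every edge is a bridge, that is, deleting it increases the number of connected
components. -/
def IsForest [DecidableEq E] (Q : G.SpanningSubgraph) : Prop :=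
  ∀ e ∈ Q.edges, Q.k < (⟨Q.edges.erase e⟩ : G.SpanningSubgraph).k

/-- A maximal spanning forest: a spanning forest not properly contained in another one. -/
def IsMaximalForest [DecidableEq E] (Q : G.SpanningSubgraph) : Prop :=
  Q.IsForest ∧ ∀ Q' : G.SpanningSubgraph, Q'.IsForest → Q.edges ⊆ Q'.edges → Q' = Q

/-! Capping off each boundary component of `Q` with a disc gives a closed surface, with a cell
structure that has the vertices as 0-cells, the edges of `Q` as 1-cells and the capping discs as
2-cells. The following is its cellular chain complex over `ℤ/2ℤ`. -/

/-- The boundary of an edge is the sum of its two ends. -/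
def boundaryOne [DecidableEq V] (Q : G.SpanningSubgraph) :
    (Q.edges → ZMod 2) →ₗ[ZMod 2] (V → ZMod 2) where
  toFun x := ∑ e, (Pi.single (G.vert (e.1, false)) (x e) + Pi.single (G.vert (e.1, true)) (x e))
  map_add' x y := by
    simp only [Pi.add_apply, Pi.single_add, ← Finset.sum_add_distrib]
    exact Finset.sum_congr rfl fun _ _ => by abel
  map_smul' r x := by
    simp only [Pi.smul_apply, Pi.single_smul, RingHom.id_apply, Finset.smul_sum, smul_add]

/-- The boundary component of `Q` (hence the 2-cell) that passes through a given corner. -/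
def boundaryAt (Q : G.SpanningSubgraph) (c : (E × Bool) × Bool) : Q.BoundaryComponent :=
  Sum.inl (Quot.mk _ c)

/-- The boundary of a 2-cell is the sum of the edges on it, counted with multiplicity: the
coefficient of `e` in the boundary of the chain `x` is the sum of the coefficients in `x` of the
2-cells at the two sides of `e`, which start at the corners `((e, false), false)` and
`((e, false), true)`. -/
def boundaryTwo (Q : G.SpanningSubgraph) :
    (Q.BoundaryComponent → ZMod 2) →ₗ[ZMod 2] (Q.edges → ZMod 2) where
  toFun x e := x (Q.boundaryAt ((e.1, false), false)) + x (Q.boundaryAt ((e.1, false), true))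
  map_add' x y := by funext e; simp only [Pi.add_apply]; abel
  map_smul' r x := by funext e; simp only [Pi.smul_apply, RingHom.id_apply, smul_add]

/-- The two boundary maps form a chain complex. -/
theorem boundaryOne_boundaryTwo [Fintype E] [DecidableEq V] (Q : G.SpanningSubgraph)
    (x : Q.BoundaryComponent → ZMod 2) : Q.boundaryOne (Q.boundaryTwo x) = 0 := by
  classical
  funext w
  have hz : ∀ a : ZMod 2, a + a = 0 := by decide
  set p : (E × Bool) × Bool → ZMod 2 := fun c => x (Q.boundaryAt c) with hp
  have hstep : ∀ c c', Q.BoundaryStep c c' → p c = p c' := fun c c' h =>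
    congrArg x (congrArg Sum.inl (Quot.sound h))
  have hsum : ∑ h : E × Bool, (if G.vert h = w then p (h, false) + p (h, true) else 0) = 0 := by
    have h1 : ∑ h : E × Bool, (if G.vert h = w then p (h, false) else 0) =
        ∑ h : E × Bool, (if G.vert h = w then p (h, true) else 0) := by
      rw [← Equiv.sum_comp G.rot]
      refine Finset.sum_congr rfl fun h _ => ?_
      rw [G.vert_rot, hstep _ _ (BoundaryStep.arc h)]
    have h2 : ∀ h : E × Bool, (if G.vert h = w then p (h, false) + p (h, true) else 0) =
        (if G.vert h = w then p (h, false) else 0) + (if G.vert h = w then p (h, true) else 0) := by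
      intro h; split_ifs <;> simp
    rw [Finset.sum_congr rfl fun h _ => h2 h, Finset.sum_add_distrib, h1, hz]
  rw [Fintype.sum_prod_type, ← Finset.sum_subset (Finset.subset_univ Q.edges)] at hsum
  · rw [Pi.zero_apply, ← hsum, ← Finset.sum_coe_sort Q.edges]
    simp only [boundaryOne, LinearMap.coe_mk, AddHom.coe_mk, Finset.sum_apply]
    refine Finset.sum_congr rfl fun e _ => ?_
    have hside : p ((e.1, true), false) + p ((e.1, true), true) =
        p ((e.1, false), false) + p ((e.1, false), true) := by
      rw [hstep _ _ (BoundaryStep.side e.1 e.2 true false),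
        hstep _ _ (BoundaryStep.side e.1 e.2 true true)]
      cases G.twisted e.1 <;> simp [add_comm]
    have htwo : Q.boundaryTwo x e = p ((e.1, false), false) + p ((e.1, false), true) := rfl
    rw [Fintype.sum_bool, hside, htwo, Pi.add_apply, Pi.single_apply, Pi.single_apply, add_comm]
    simp only [eq_comm]
  · intro e _ he
    refine Finset.sum_eq_zero fun b _ => ?_
    rw [hstep _ _ (BoundaryStep.segment e he b), hz, ite_self]

/-- The Euler genus `γ(Q)`, as the dimension of the first homology group with coefficients in
`ℤ/2ℤ` of the closed surface obtained by capping off the boundary components of `Q`. This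
dimension is `2g` for the orientable surface of genus `g`, it is `g` for the non-orientable surface
of genus `g`, and it is additive over connected components. -/
noncomputable def eulerGenus [DecidableEq V] (Q : G.SpanningSubgraph) : ℕ :=
  Module.finrank (ZMod 2)
    (LinearMap.ker Q.boundaryOne ⧸
      (LinearMap.range Q.boundaryTwo).comap (LinearMap.ker Q.boundaryOne).subtype)

end SpanningSubgraph

/-- The number `v(G)` of vertices. -/
def v [Fintype V] (_G : RibbonGraph V E) : ℕ := Fintype.card V

/-- The number `k(G)` of connected components. -/
noncomputable def k [Fintype E] (G : RibbonGraph V E) : ℕ := G.whole.k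

/-- The Euler genus `γ(G)`. -/
noncomputable def eulerGenus [Fintype E] [DecidableEq V] (G : RibbonGraph V E) : ℕ :=
  G.whole.eulerGenus

/-- `D(G)`: the feasible sets are the edge sets of the spanning quasi-trees of `G`. -/
def deltaMatroid [Fintype E] (G : RibbonGraph V E) : SetSystem E :=
  ⟨{F | ∃ Q : G.SpanningSubgraph, Q.IsQuasiTree ∧ Q.edges = F}⟩

end RibbonGraph

/-
The boundary components of `(V, A)` that meet an edge segment are the circles obtained by
alternating two fixed-point-free involutions of the corners: the arcs of the vertex discs, which do
not depend on `A`, and a pairing of the four corners of each edge, which is one of two pairings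
according to whether the edge lies in `A`. Cutting an edge open leaves strands that join its four
corners in pairs, and reinserting the edge creates two circles if its pairing is the one given by
the strands, and a single circle otherwise. So adding or deleting an edge changes the number `f` of
boundary components by at most one, and a spanning quasi-tree is a subset at which `f` attains its
lower bound `k(G)`. If toggling `u` raises `f` above `k(G)` and no second toggle brings it back,
then every other edge of `X ∆ Y` has all its corners on one circle, so `f` cannot come back to
`k(G)` at `Y` either: this is symmetric exchange. Cardinalities translate into Euler genera by
Euler's formula `γ + v + f = |A| + 2k`. An orientation of `G` is a two-colouring of the corners that
alternates along every pairing; it forces each toggle to change the parity of `f`. Conversely, if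
every toggle at a quasi-tree raises `f`, then a colouring that alternates along its circles also
alternates along the pairings of all other subgraphs.
-/

section Quotient

variable {α β : Type*} {r s : α → α → Prop}

theorem quot_apply_eq_of_mk_eq {g : α → β} (h : ∀ x y, r x y → g x = g y) {x y : α}
    (hxy : Quot.mk r x = Quot.mk r y) : g x = g y :=
  congrArg (Quot.lift g h) hxy

theorem card_quot_le_card_quot [Finite α] (h : ∀ x y, r x y → Quot.mk s x = Quot.mk s y) :
    Nat.card (Quot s) ≤ Nat.card (Quot r) :=
  Nat.card_le_card_of_surjective (Quot.lift (Quot.mk s) h) fun q =>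
    q.inductionOn fun x => ⟨Quot.mk r x, rfl⟩

theorem card_quot_add_one [Finite α] {a b : α}
    (hrs : ∀ x y, r x y → Quot.mk s x = Quot.mk s y) (hab : Quot.mk s a = Quot.mk s b)
    (hsr : ∀ x y, s x y →
      Quot.mk r x = Quot.mk r y ∨ s(Quot.mk r x, Quot.mk r y) = s(Quot.mk r a, Quot.mk r b))
    (hne : Quot.mk r a ≠ Quot.mk r b) : Nat.card (Quot s) + 1 = Nat.card (Quot r) := by
  classical
  let merge : Quot r → {q // q ≠ Quot.mk r b} := fun q =>
    if h : q = Quot.mk r b then ⟨Quot.mk r a, hne⟩ else ⟨q, h⟩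
  have merge_eq (x y : α) (h : s x y) : merge (Quot.mk r x) = merge (Quot.mk r y) := by
    rcases hsr x y h with h | h
    · rw [h]
    · rcases Sym2.eq_iff.1 h with ⟨hx, hy⟩ | ⟨hx, hy⟩ <;> simp [merge, hx, hy, hne]
  have mk_merge (x : α) :
      Quot.lift (Quot.mk s) hrs (merge (Quot.mk r x) : Quot r) = Quot.mk s x := by
    by_cases h : Quot.mk r x = Quot.mk r b
    · simpa [merge, h] using hab.trans (quot_apply_eq_of_mk_eq hrs h.symm)
    · simp [merge, h]
  have merge_mk (q : {q // q ≠ Quot.mk r b}) : merge q = q := dif_neg q.2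
  let e : Quot s ≃ {q // q ≠ Quot.mk r b} :=
    { toFun := Quot.lift (fun x => merge (Quot.mk r x)) merge_eq
      invFun := fun q => Quot.lift (Quot.mk s) hrs q.1
      left_inv := fun q => q.inductionOn mk_merge
      right_inv := by rintro ⟨⟨x⟩, hx⟩; exact merge_mk ⟨_, hx⟩ }
  rw [Nat.card_congr e, ← Finite.card_option,
    Nat.card_congr (Equiv.optionSubtypeNe (Quot.mk r b))]

end Quotient

section AlternatingColoring

variable {C : Type*} {α β : C → C}

theorem exists_coloring_of_involutive (hα : Function.Involutive α) (hα' : ∀ x, α x ≠ x) :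
    ∃ c : C → Bool, ∀ x, c (α x) = !c x := by
  classical
  let _ : LinearOrder C := linearOrderOfSTO WellOrderingRel
  refine ⟨fun x => decide (x < α x), fun x => ?_⟩
  simp only [hα x, ← decide_not, decide_eq_decide, not_lt]
  exact ⟨le_of_lt, fun h => lt_of_le_of_ne h (hα' x)⟩

theorem toPerm_apply_zpow_mul_toPerm (hα : Function.Involutive α) (hβ : Function.Involutive β)
    (n : ℤ) (x : C) :
    α (((hα.toPerm * hβ.toPerm) ^ n) x) = ((hα.toPerm * hβ.toPerm) ^ (-n)) (α x) := by
  have hp : hα.toPerm * hα.toPerm = 1 := Equiv.ext hα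
  have hq : hβ.toPerm * hβ.toPerm = 1 := Equiv.ext hβ
  have h : SemiconjBy hα.toPerm (hα.toPerm * hβ.toPerm) (hα.toPerm * hβ.toPerm)⁻¹ := by
    rw [SemiconjBy, mul_inv_rev, inv_eq_of_mul_eq_one_left hp, inv_eq_of_mul_eq_one_left hq,
      mul_assoc, hp, ← mul_assoc, hp, one_mul, mul_one]
  have hn := h.zpow_right n
  rw [inv_zpow'] at hn
  exact DFunLike.congr_fun hn x

theorem not_sameCycle_toPerm_mul_toPerm (hα : Function.Involutive α)
    (hβ : Function.Involutive β) (hα' : ∀ x, α x ≠ x) (hβ' : ∀ x, β x ≠ x) (x : C) :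
    ¬ (hα.toPerm * hβ.toPerm).SameCycle x (α x) := by
  rintro ⟨n, hn⟩
  set σ := hα.toPerm * hβ.toPerm
  have reflect (k l : ℤ) (hkl : k + l = n) : α ((σ ^ k) x) = (σ ^ l) x := by
    rw [toPerm_apply_zpow_mul_toPerm hα hβ, ← hn, ← Equiv.Perm.mul_apply, ← zpow_add]
    congr 2
    omega
  rcases Int.even_or_odd' n with ⟨m, rfl | rfl⟩
  · exact hα' _ (reflect m m (by omega))
  · refine hβ' ((σ ^ m) x) ?_
    calc β ((σ ^ m) x) = α (σ ((σ ^ m) x)) := (hα _).symm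
      _ = α ((σ ^ (1 + m)) x) := by rw [zpow_one_add]; rfl
      _ = (σ ^ m) x := reflect _ _ (by omega)

-- Both involutions reverse the cyclic order in which `α ∘ β` runs through its cycles, and they
-- induce the same fixed-point-free involution on the set of these cycles.
theorem exists_alternating_coloring (hα : Function.Involutive α) (hβ : Function.Involutive β)
    (hα' : ∀ x, α x ≠ x) (hβ' : ∀ x, β x ≠ x) :
    ∃ c : C → Bool, ∀ x, c (α x) = !c x ∧ c (β x) = !c x := by
  set σ := hα.toPerm * hβ.toPerm
  let cycleOf : C → Quotient (Equiv.Perm.SameCycle.setoid σ) := Quotient.mk _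
  let swap : Quotient (Equiv.Perm.SameCycle.setoid σ) → Quotient (Equiv.Perm.SameCycle.setoid σ) :=
    Quotient.map α fun x y ⟨n, hn⟩ =>
      ⟨-n, by rw [← toPerm_apply_zpow_mul_toPerm hα hβ, hn]⟩
  have swap_involutive : Function.Involutive swap := fun q =>
    q.inductionOn fun x => congrArg cycleOf (hα x)
  have swap_ne (q) : swap q ≠ q := q.inductionOn fun x h =>
    not_sameCycle_toPerm_mul_toPerm hα hβ hα' hβ' x (Quotient.exact h.symm)
  have cycleOf_β (x : C) : cycleOf (β x) = swap (cycleOf x) :=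
    Quotient.sound ⟨1, by rw [zpow_one]; exact congrArg α (hβ x)⟩
  obtain ⟨c, hc⟩ := exists_coloring_of_involutive swap_involutive swap_ne
  exact ⟨c ∘ cycleOf, fun x => ⟨hc (cycleOf x), (congrArg c (cycleOf_β x)).trans (hc _)⟩⟩

end AlternatingColoring

theorem even_card_of_involutive {α : Type*} {S : Finset α} {g : α → α}
    (hg : Function.Involutive g) (hmem : ∀ x ∈ S, g x ∈ S) (hne : ∀ x ∈ S, g x ≠ x) :
    Even S.card := by
  rw [← ZMod.natCast_eq_zero_iff_even, Finset.cast_card]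
  exact Finset.sum_involution (fun x _ => g x) (fun _ _ => by decide) (fun x hx _ => hne x hx)
    hmem (fun x _ => hg x)

namespace RibbonGraph

variable {V E : Type*}

/-! ## States and their circles -/

/-- The corners of the edge discs: `(h, false)` and `(h, true)` are the end points of the
attaching segment of the half-edge `h`, in the order in which they are met around its vertex. -/
abbrev Corner (E : Type*) : Type _ := (E × Bool) × Bool

/-- The Klein four-group `Bool × Bool`, whose addition is componentwise `xor`, permutes the four
corners of each edge simply transitively. -/
def shift (t : Bool × Bool) (x : Corner E) : Corner E := ((x.1.1, x.1.2 + t.1), x.2 + t.2)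

theorem klein_add_eq_zero_iff {t u : Bool × Bool} : t + u = 0 ↔ t = u := by decide +revert

theorem klein_add_add_cancel (t u : Bool × Bool) : t + (t + u) = u := by decide +revert

theorem klein_coset_cases {t t₀ : Bool × Bool} (ht₀ : t₀ ≠ 0) (ht : t ≠ 0) (htt₀ : t ≠ t₀)
    (u : Bool × Bool) : (u = 0 ∨ u = t₀) ∨ (t + u = 0 ∨ t + u = t₀) := by decide +revert

theorem klein_add_eq_of_ne {t u w : Bool × Bool} (ht : t ≠ 0) (hu : u ≠ 0) (hw : w ≠ 0)
    (htu : t ≠ u) (htw : t ≠ w) (huw : u ≠ w) : t + u = w := by decide +revert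

theorem shift_fst_fst (t : Bool × Bool) (x : Corner E) : (shift t x).1.1 = x.1.1 := rfl

theorem shift_zero (x : Corner E) : shift 0 x = x := by simp [shift]

theorem shift_shift (t u : Bool × Bool) (x : Corner E) : shift t (shift u x) = shift (u + t) x := by
  simp [shift, add_assoc]

theorem shift_ne {t : Bool × Bool} (ht : t ≠ 0) (x : Corner E) : shift t x ≠ x := by
  simpa [shift, Prod.ext_iff] using ht

theorem exists_shift_eq {x y : Corner E} (h : x.1.1 = y.1.1) : ∃ t, shift t x = y :=
  ⟨(x.1.2 + y.1.2, x.2 + y.2), by simp [shift, h, ← add_assoc, BooleanRing.add_self]⟩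

/-- The other end point of the arc of a vertex disc that starts at the corner `x`. -/
def arcEnd (G : RibbonGraph V E) (x : Corner E) : Corner E :=
  if x.2 then (G.rot x.1, false) else (G.rot.symm x.1, true)

theorem arcEnd_involutive (G : RibbonGraph V E) : Function.Involutive G.arcEnd := by
  rintro ⟨h, _ | _⟩ <;> simp [arcEnd]

theorem arcEnd_snd (G : RibbonGraph V E) (x : Corner E) : (G.arcEnd x).2 = !x.2 := by
  rcases x with ⟨h, _ | _⟩ <;> rfl

theorem vert_arcEnd (G : RibbonGraph V E) (x : Corner E) :
    G.vert (G.arcEnd x).1 = G.vert x.1 := by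
  obtain ⟨h, _ | _⟩ := x
  · simpa [arcEnd] using (G.vert_rot (G.rot.symm h)).symm
  · exact G.vert_rot h

theorem arcEnd_ne (G : RibbonGraph V E) (x : Corner E) : G.arcEnd x ≠ x := fun h =>
  Bool.not_ne_self x.2 ((G.arcEnd_snd x).symm.trans (congrArg Prod.snd h))

/-- A state `s` gives for each edge `e` a pairing of its four corners, the one in which `s e` joins
each corner to its translate. The state `0` at `e` cuts `e` open: its corners stay unpaired. -/
def pairing (s : E → Bool × Bool) (x : Corner E) : Corner E := shift (s x.1.1) x

theorem pairing_involutive (s : E → Bool × Bool) : Function.Involutive (pairing s) := fun x => by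
  simp [pairing, shift, add_assoc, BooleanRing.add_self]

/-- The steps that trace out the circles (and, at edges that are cut open, strands) formed by the
arcs of the vertex discs together with the pairings of the state `s`. -/
def StateStep (G : RibbonGraph V E) (s : E → Bool × Bool) (x y : Corner E) : Prop :=
  y = G.arcEnd x ∨ y = pairing s x

/-- The circles and strands of a state. -/
def Circle (G : RibbonGraph V E) (s : E → Bool × Bool) : Type _ := Quot (G.StateStep s)

/-- The circle or strand through a corner. -/
def circleAt (G : RibbonGraph V E) (s : E → Bool × Bool) (x : Corner E) : G.Circle s :=
  Quot.mk _ x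

/-- The number of circles and strands of a state. -/
noncomputable def circles (G : RibbonGraph V E) (s : E → Bool × Bool) : ℕ := Nat.card (G.Circle s)

variable {G : RibbonGraph V E} {s s' : E → Bool × Bool} {x y : Corner E}

theorem circleAt_arcEnd : G.circleAt s (G.arcEnd x) = G.circleAt s x :=
  (Quot.sound (show G.StateStep s x (G.arcEnd x) from Or.inl rfl)).symm

theorem circleAt_pairing : G.circleAt s (pairing s x) = G.circleAt s x :=
  (Quot.sound (show G.StateStep s x (pairing s x) from Or.inr rfl)).symm

theorem circleAt_shift : G.circleAt s (shift (s x.1.1) x) = G.circleAt s x :=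
  circleAt_pairing

theorem apply_eq_of_circleAt_eq {β : Type*} {g : Corner E → β} (harc : ∀ x, g (G.arcEnd x) = g x)
    (hpair : ∀ x, g (pairing s x) = g x) (h : G.circleAt s x = G.circleAt s y) : g x = g y :=
  quot_apply_eq_of_mk_eq
    (fun x y hxy => by rcases hxy with rfl | rfl; exacts [(harc x).symm, (hpair x).symm]) h

theorem circles_le_circles [Finite E]
    (h : ∀ x, G.circleAt s' (pairing s x) = G.circleAt s' x) : G.circles s' ≤ G.circles s :=
  card_quot_le_card_quot fun x y hxy => by
    rcases hxy with rfl | rfl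
    exacts [circleAt_arcEnd.symm, (h x).symm]

/-! ## Alternating colourings of the corners -/

/-- Two colours alternate along every circle and every strand of the state `s`. -/
structure IsAlternating (G : RibbonGraph V E) (s : E → Bool × Bool) (c : Corner E → Bool) :
    Prop where
  apply_arcEnd : ∀ x, c (G.arcEnd x) = !c x
  apply_pairing : ∀ x, s x.1.1 ≠ 0 → c (pairing s x) = !c x

theorem exists_isAlternating (G : RibbonGraph V E) (s : E → Bool × Bool) :
    ∃ c, G.IsAlternating s c := by
  classical
  let s' : E → Bool × Bool := fun e => if s e = 0 then (false, true) else s e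
  have hs' (e) : s' e ≠ 0 := by
    by_cases h : s e = 0
    · simp [s', h]
    · simp [s', h]
  obtain ⟨c, hc⟩ := exists_alternating_coloring G.arcEnd_involutive (pairing_involutive s')
    G.arcEnd_ne fun x => shift_ne (hs' x.1.1) x
  exact ⟨c, fun x => (hc x).1, fun x hx => by simpa [pairing, s', hx] using (hc x).2⟩

theorem IsAlternating.apply_eq_iff {c d : Corner E → Bool} (hc : G.IsAlternating s c)
    (hd : G.IsAlternating s d) (h : G.circleAt s x = G.circleAt s y) :
    c x = c y ↔ d x = d y := by
  have hcd : (c x ^^ d x) = (c y ^^ d y) := by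
    refine apply_eq_of_circleAt_eq (g := fun z => c z ^^ d z) (fun z => ?_) (fun z => ?_) h
    · rw [hc.apply_arcEnd, hd.apply_arcEnd, Bool.not_xor_not]
    · by_cases hz : s z.1.1 = 0
      · simp only [pairing, hz, shift_zero]
      · rw [hc.apply_pairing z hz, hd.apply_pairing z hz, Bool.not_xor_not]
  revert hcd
  cases c x <;> cases c y <;> cases d x <;> cases d y <;> decide

/-! ## Changing the state at one edge -/

section Cut

variable [DecidableEq E] {e : E} {t t₀ u : Bool × Bool}

/-- The state that cuts `e` open and agrees with `s` at the other edges. -/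
abbrev cut (s : E → Bool × Bool) (e : E) : E → Bool × Bool := Function.update s e 0

theorem cut_update : cut (Function.update s e t) e = cut s e := Function.update_idem ..

theorem pairing_update_of_ne (h : x.1.1 ≠ e) : pairing (Function.update s e t) x = pairing s x := by
  simp only [pairing, Function.update_of_ne h]

theorem pairing_update_self (h : x.1.1 = e) : pairing (Function.update s e t) x = shift t x := by
  simp only [pairing, h, Function.update_self]

theorem circleAt_pairing_cut : G.circleAt s (pairing (cut s e) x) = G.circleAt s x := by
  by_cases h : x.1.1 = e
  · rw [pairing_update_self h, shift_zero]
  · rw [pairing_update_of_ne h, circleAt_pairing]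

theorem circleAt_eq_of_cut (h : G.circleAt (cut s e) x = G.circleAt (cut s e) y) :
    G.circleAt s x = G.circleAt s y :=
  apply_eq_of_circleAt_eq (fun _ => circleAt_arcEnd) (fun _ => circleAt_pairing_cut) h

theorem IsAlternating.isAlternating_cut {c : Corner E → Bool} (hc : G.IsAlternating s c) (e : E) :
    G.IsAlternating (cut s e) c where
  apply_arcEnd := hc.apply_arcEnd
  apply_pairing x hx := by
    have hxe : x.1.1 ≠ e := by
      rintro rfl
      exact hx (Function.update_self ..)
    rw [cut, Function.update_of_ne hxe] at hx
    rw [pairing_update_of_ne hxe, hc.apply_pairing x hx]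

-- Closing the strand with the state `t` at `e` gives a circle along which the colours also
-- alternate across `e`.
theorem IsAlternating.apply_shift_of_circleAt_eq {c : Corner E → Bool} (ht : t ≠ 0)
    (hc : G.IsAlternating (cut s e) c) (hx : x.1.1 = e)
    (h : G.circleAt (cut s e) (shift t x) = G.circleAt (cut s e) x) : c (shift t x) = !c x := by
  obtain ⟨d, hd⟩ := exists_isAlternating G (Function.update s e t)
  have hdx : d (shift t x) = !d x := by
    rw [← hd.apply_pairing x (by rwa [hx, Function.update_self]), pairing_update_self hx]
  have hd₀ := hd.isAlternating_cut e
  rw [cut_update] at hd₀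
  have hne : c (shift t x) ≠ c x := by
    rw [Ne, hc.apply_eq_iff hd₀ h, hdx]
    exact Bool.not_ne_self _
  exact Bool.eq_not_of_ne hne

theorem eq_of_circleAt_cut_eq (ht : t ≠ 0) (hu : u ≠ 0) (hx : x.1.1 = e)
    (hxt : G.circleAt (cut s e) (shift t x) = G.circleAt (cut s e) x)
    (hxu : G.circleAt (cut s e) (shift u x) = G.circleAt (cut s e) x) : t = u := by
  by_contra htu
  have htu' : t + u ≠ 0 := mt klein_add_eq_zero_iff.1 htu
  obtain ⟨c, hc⟩ := exists_isAlternating G (Function.update s e (t + u))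
  have hc₀ := hc.isAlternating_cut e
  rw [cut_update] at hc₀
  have hct := hc₀.apply_shift_of_circleAt_eq ht hx hxt
  have hcu := hc₀.apply_shift_of_circleAt_eq hu hx hxu
  have hctu := hc.apply_pairing (shift t x) (by rwa [shift_fst_fst, hx, Function.update_self])
  rw [pairing_update_self (x := shift t x) hx, shift_shift, klein_add_add_cancel, hct, hcu,
    Bool.not_not] at hctu
  exact Bool.not_ne_self _ hctu

-- All other corners of a strand are paired up, once by the arcs without exception and once by the
-- state away from `e`, so the number of corners of `e` on the strand is even.
theorem exists_circleAt_cut_eq [Finite E] (hs : ∀ i, i ≠ e → s i ≠ 0) (hx : x.1.1 = e) :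
    ∃ t, t ≠ 0 ∧ G.circleAt (cut s e) (shift t x) = G.circleAt (cut s e) x := by
  have := Fintype.ofFinite E
  classical
  by_contra! hne
  set s₀ := cut s e
  let strand : Finset (Corner E) := {y | G.circleAt s₀ y = G.circleAt s₀ x}
  have even_strand : Even strand.card :=
    even_card_of_involutive G.arcEnd_involutive
      (fun y hy => by simpa [strand, circleAt_arcEnd] using hy) fun y _ => G.arcEnd_ne y
  have pairing_x : pairing s₀ x = x := by rw [pairing_update_self hx, shift_zero]
  have even_erase : Even (strand.erase x).card := by
    refine even_card_of_involutive (pairing_involutive s₀) (fun y hy => ?_) fun y hy => ?_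
    · simp only [strand, Finset.mem_erase, Finset.mem_filter_univ, circleAt_pairing] at hy ⊢
      exact ⟨fun h => hy.1 ((pairing_involutive s₀).injective (h.trans pairing_x.symm)), hy.2⟩
    · simp only [strand, Finset.mem_erase, Finset.mem_filter_univ] at hy
      have hye : y.1.1 ≠ e := by
        intro hye
        obtain ⟨t, rfl⟩ := exists_shift_eq (hx.trans hye.symm)
        exact hne t (fun ht => hy.1 (by rw [ht, shift_zero])) hy.2
      rw [pairing_update_of_ne hye]
      exact shift_ne (hs _ hye) y
  have hcard : (strand.erase x).card + 1 = strand.card :=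
    Finset.card_erase_add_one (by simp [strand])
  rw [← hcard, Nat.even_add_one] at even_strand
  exact even_strand even_erase

/-- Once `e` is cut open, the strands that end at the corners of `e` join each corner to its
translate by `t₀`. -/
structure IsStrandPairing (G : RibbonGraph V E) (s : E → Bool × Bool) (e : E)
    (t₀ : Bool × Bool) : Prop where
  ne_zero : t₀ ≠ 0
  circleAt_shift_eq_iff : ∀ x : Corner E, x.1.1 = e → ∀ t,
    G.circleAt (cut s e) (shift t x) = G.circleAt (cut s e) x ↔ t = 0 ∨ t = t₀

theorem exists_isStrandPairing [Finite E] (G : RibbonGraph V E) (hs : ∀ i, i ≠ e → s i ≠ 0) :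
    ∃ t₀, G.IsStrandPairing s e t₀ := by
  set x₀ : Corner E := ((e, false), false)
  obtain ⟨t₀, ht₀, hx₀⟩ := exists_circleAt_cut_eq (G := G) (x := x₀) hs rfl
  have strand_x₀ (u) (hu : G.circleAt (cut s e) (shift u x₀) = G.circleAt (cut s e) x₀) :
      u = 0 ∨ u = t₀ :=
    or_iff_not_imp_left.2 fun hu₀ => eq_of_circleAt_cut_eq (x := x₀) hu₀ ht₀ rfl hu hx₀
  suffices h : ∀ x : Corner E, x.1.1 = e →
      G.circleAt (cut s e) (shift t₀ x) = G.circleAt (cut s e) x by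
    refine ⟨t₀, ht₀, fun x hx t => ⟨fun ht => or_iff_not_imp_left.2 fun ht' => ?_, ?_⟩⟩
    · exact eq_of_circleAt_cut_eq ht' ht₀ hx ht (h x hx)
    · rintro (rfl | rfl)
      exacts [by rw [shift_zero], h x hx]
  intro x hx
  obtain ⟨u, rfl⟩ := exists_shift_eq (x := x₀) hx.symm
  by_cases hu : u = 0 ∨ u = t₀
  · rcases hu with rfl | rfl
    · rwa [shift_zero]
    · rw [shift_shift, klein_add_eq_zero_iff.2 rfl, shift_zero, hx₀]
  · obtain ⟨t, ht, hxt⟩ := exists_circleAt_cut_eq (G := G) hs hx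
    rw [shift_shift] at hxt
    have hut : ¬ (u + t = 0 ∨ u + t = t₀) := fun h => hu <| strand_x₀ u <| hxt.symm.trans <| by
      rcases h with h | h <;> rw [h]
      exacts [by rw [shift_zero], hx₀]
    have ht_eq : t = t₀ := ((klein_coset_cases ht₀ (fun h => hu (Or.inl h))
      (fun h => hu (Or.inr h)) t).resolve_right hut).resolve_left ht
    rw [← ht_eq, shift_shift, hxt]

theorem IsStrandPairing.circleAt_shift_eq_shift_iff (h : G.IsStrandPairing s e t₀)
    (hx : x.1.1 = e) :
    G.circleAt (cut s e) (shift t x) = G.circleAt (cut s e) (shift u x) ↔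
      u + t = 0 ∨ u + t = t₀ := by
  rw [← h.circleAt_shift_eq_iff (shift u x) hx, shift_shift, klein_add_add_cancel]

theorem IsStrandPairing.circles_eq [Finite E] (h : G.IsStrandPairing s e (s e)) :
    G.circles s = G.circles (cut s e) := by
  refine le_antisymm (circles_le_circles fun x => circleAt_pairing_cut)
    (circles_le_circles fun x => ?_)
  by_cases hx : x.1.1 = e
  · rw [pairing, hx, h.circleAt_shift_eq_iff x hx]
    exact Or.inr rfl
  · rw [← pairing_update_of_ne hx, circleAt_pairing]

theorem IsStrandPairing.circles_add_one [Finite E] (h : G.IsStrandPairing s e t₀) (hs : s e ≠ 0)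
    (hst : s e ≠ t₀) : G.circles s + 1 = G.circles (cut s e) := by
  set x₀ : Corner E := ((e, false), false)
  refine card_quot_add_one (a := x₀) (b := shift (s e) x₀) (fun x y hxy => ?_)
    (circleAt_shift (x := x₀)).symm (fun x y hxy => ?_) ?_
  · rcases hxy with rfl | rfl
    exacts [circleAt_arcEnd.symm, circleAt_pairing_cut.symm]
  · rcases hxy with rfl | rfl
    · exact Or.inl circleAt_arcEnd.symm
    by_cases hx : x.1.1 = e
    · obtain ⟨q, rfl⟩ := exists_shift_eq (x := x₀) hx.symm
      have hq : (G.circleAt (cut s e) (shift q x₀) = G.circleAt (cut s e) (shift 0 x₀) ∧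
            G.circleAt (cut s e) (shift (q + s e) x₀) = G.circleAt (cut s e) (shift (s e) x₀)) ∨
          (G.circleAt (cut s e) (shift q x₀) = G.circleAt (cut s e) (shift (s e) x₀) ∧
            G.circleAt (cut s e) (shift (q + s e) x₀) = G.circleAt (cut s e) (shift 0 x₀)) := by
        simp only [h.circleAt_shift_eq_shift_iff (x := x₀) rfl, zero_add, add_comm q,
          klein_add_add_cancel, and_self]
        exact klein_coset_cases h.ne_zero hs hst q
      rw [shift_zero, ← shift_shift] at hq
      exact Or.inr (Sym2.eq_iff.2 hq)
    · rw [← pairing_update_of_ne hx]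
      exact Or.inl circleAt_pairing.symm
  · exact fun heq => ((h.circleAt_shift_eq_iff x₀ rfl (s e)).1 heq.symm).elim hs hst

theorem IsStrandPairing.circleAt_eq_of_ne (h : G.IsStrandPairing s e t₀) (hs : s e ≠ 0)
    (hst : s e ≠ t₀) (hx : x.1.1 = e) (hy : y.1.1 = e) : G.circleAt s x = G.circleAt s y := by
  obtain ⟨q, rfl⟩ := exists_shift_eq (hx.trans hy.symm)
  have hq : G.circleAt (cut s e) (shift q x) = G.circleAt (cut s e) (shift 0 x) ∨
      G.circleAt (cut s e) (shift q x) = G.circleAt (cut s e) (shift (s e) x) := by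
    simp only [h.circleAt_shift_eq_shift_iff hx, zero_add]
    exact klein_coset_cases h.ne_zero hs hst q
  rcases hq with hq | hq
  · rw [circleAt_eq_of_cut hq, shift_zero]
  · rw [circleAt_eq_of_cut hq, ← hx, circleAt_shift]

end Cut

end RibbonGraph

/-! ## Boundary components -/

namespace RibbonGraph.SpanningSubgraph

variable {V E : Type*} {G : RibbonGraph V E}

/-- The spanning ribbon subgraph obtained from `Q` by deleting `e` if it is present and adding it
otherwise. -/
def toggle [DecidableEq E] (Q : G.SpanningSubgraph) (e : E) : G.SpanningSubgraph :=
  ⟨symmDiff Q.edges {e}⟩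

open Classical in
/-- The state whose circles are the boundary components of `Q` that pass through corners: these
cross the sides of the edges of `Q` and the attaching segments of the other edges. -/
noncomputable def state (Q : G.SpanningSubgraph) (e : E) : Bool × Bool :=
  if e ∈ Q.edges then (true, !G.twisted e) else (false, true)

variable {Q : G.SpanningSubgraph} {e : E} {x y : Corner E} {t₀ : Bool × Bool}

theorem state_of_mem (he : e ∈ Q.edges) : Q.state e = (true, !G.twisted e) := if_pos he

theorem state_of_notMem (he : e ∉ Q.edges) : Q.state e = (false, true) := if_neg he

theorem state_ne_zero (Q : G.SpanningSubgraph) (e : E) : Q.state e ≠ 0 := by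
  unfold state
  split_ifs <;> simp

theorem state_congr {Q' : G.SpanningSubgraph} (h : e ∈ Q.edges ↔ e ∈ Q'.edges) :
    Q.state e = Q'.state e := by
  by_cases he : e ∈ Q.edges
  · rw [state_of_mem he, state_of_mem (h.1 he)]
  · rw [state_of_notMem he, state_of_notMem (mt h.2 he)]

theorem pairing_state_of_mem (he : e ∈ Q.edges) (b s : Bool) :
    pairing Q.state ((e, b), s) = ((e, !b), xor s (!G.twisted e)) := by
  rw [pairing, state_of_mem he, ← Bool.xor_true b]
  rfl

theorem pairing_state_of_notMem (he : e ∉ Q.edges) (b s : Bool) :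
    pairing Q.state ((e, b), s) = ((e, b), !s) := by
  rw [pairing, state_of_notMem he, ← Bool.xor_true s]
  exact congrArg (fun b' => ((e, b'), xor s true)) (Bool.xor_false b)

theorem boundaryAt_eq_iff :
    Q.boundaryAt x = Q.boundaryAt y ↔ G.circleAt Q.state x = G.circleAt Q.state y := by
  refine Sum.inl_injective.eq_iff.trans ⟨?_, ?_⟩
  · refine quot_apply_eq_of_mk_eq fun x y h => ?_
    cases h with
    | arc h => exact (circleAt_arcEnd (x := (h, true))).symm
    | side e he b s => rw [← pairing_state_of_mem he, circleAt_pairing]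
    | segment e he b =>
      rw [← Bool.not_false, ← pairing_state_of_notMem he, circleAt_pairing]
  · refine apply_eq_of_circleAt_eq ?_ ?_
    · rintro ⟨h, _ | _⟩
      · simpa [arcEnd] using Quot.sound (BoundaryStep.arc (Q := Q) (G.rot.symm h))
      · exact (Quot.sound (BoundaryStep.arc h)).symm
    · rintro ⟨⟨e, b⟩, s⟩
      by_cases he : e ∈ Q.edges
      · rw [pairing_state_of_mem he, Quot.sound (BoundaryStep.side e he b s)]
      · rw [pairing_state_of_notMem he]
        have := Quot.sound (BoundaryStep.segment e he b)
        cases s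
        exacts [this.symm, this]

theorem f_eq_circles_add [Finite V] [Finite E] (Q : G.SpanningSubgraph) :
    Q.f = G.circles Q.state + Nat.card {v : V // ∀ h, G.vert h ≠ v} := by
  have h : Nat.card (Quot Q.BoundaryStep) = G.circles Q.state :=
    le_antisymm
      (card_quot_le_card_quot fun _ _ hxy =>
        Sum.inl_injective (boundaryAt_eq_iff.2 (Quot.sound hxy)))
      (card_quot_le_card_quot fun _ _ hxy =>
        boundaryAt_eq_iff.1 (congrArg Sum.inl (Quot.sound hxy)))
  rw [f, BoundaryComponent, Nat.card_sum, h]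

theorem f_le_f_of_boundaryAt_eq [DecidableEq E] [Finite V] [Finite E] {Q' : G.SpanningSubgraph}
    (h : ∀ x y : Corner E, x.1.1 = y.1.1 → x.1.1 ∈ symmDiff Q.edges Q'.edges →
      Q.boundaryAt x = Q.boundaryAt y) : Q.f ≤ Q'.f := by
  rw [f_eq_circles_add, f_eq_circles_add]
  refine Nat.add_le_add_right (circles_le_circles fun x => ?_) _
  by_cases hx : x.1.1 ∈ symmDiff Q.edges Q'.edges
  · exact (boundaryAt_eq_iff.1 (h x _ (shift_fst_fst _ x).symm hx)).symm
  · have hstate : Q'.state x.1.1 = Q.state x.1.1 := by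
      rw [Finset.mem_symmDiff] at hx
      exact state_congr (by tauto)
    rw [pairing, hstate, circleAt_shift]

section Toggle

variable [DecidableEq E]

theorem mem_toggle_iff {i : E} : i ∈ (Q.toggle e).edges ↔ (i ∈ Q.edges ↔ i ≠ e) := by
  rw [toggle, Finset.mem_symmDiff, Finset.mem_singleton]
  tauto

theorem toggle_toggle (Q : G.SpanningSubgraph) (e : E) : (Q.toggle e).toggle e = Q :=
  SpanningSubgraph.ext (symmDiff_symmDiff_cancel_right _ _)

theorem toggle_of_mem (he : e ∈ Q.edges) : Q.toggle e = ⟨Q.edges.erase e⟩ := by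
  ext i
  rw [mem_toggle_iff, Finset.mem_erase]
  by_cases hi : i = e <;> simp_all

theorem toggle_of_notMem (he : e ∉ Q.edges) : Q.toggle e = ⟨insert e Q.edges⟩ := by
  ext i
  rw [mem_toggle_iff, Finset.mem_insert]
  by_cases hi : i = e <;> simp_all

theorem state_toggle_ne (Q : G.SpanningSubgraph) (e : E) : (Q.toggle e).state e ≠ Q.state e := by
  by_cases he : e ∈ Q.edges
  · rw [state_of_mem he, state_of_notMem (mt mem_toggle_iff.1 (by simp [he]))]
    simp
  · rw [state_of_notMem he, state_of_mem (mem_toggle_iff.2 (by simp [he]))]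
    simp

theorem cut_state_toggle (Q : G.SpanningSubgraph) (e : E) :
    cut (Q.toggle e).state e = cut Q.state e := by
  funext i
  by_cases hi : i = e
  · rw [hi, cut, cut, Function.update_self, Function.update_self]
  · rw [cut, cut, Function.update_of_ne hi, Function.update_of_ne hi]
    exact state_congr (by simp [mem_toggle_iff, hi])

theorem exists_isStrandPairing_state [Finite E] (Q : G.SpanningSubgraph) (e : E) :
    ∃ t₀, G.IsStrandPairing Q.state e t₀ :=
  exists_isStrandPairing G fun i _ => Q.state_ne_zero i

theorem isStrandPairing_state_toggle (h : G.IsStrandPairing Q.state e t₀) :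
    G.IsStrandPairing (Q.toggle e).state e t₀ :=
  ⟨h.ne_zero, by rw [cut_state_toggle]; exact h.circleAt_shift_eq_iff⟩

variable [Finite V] [Finite E]

theorem f_add_one_eq_of_isStrandPairing (h : G.IsStrandPairing Q.state e t₀) (hQ : Q.state e ≠ t₀) :
    Q.f + 1 = G.circles (cut Q.state e) + Nat.card {v : V // ∀ h, G.vert h ≠ v} := by
  rw [f_eq_circles_add, ← h.circles_add_one (Q.state_ne_zero e) hQ, add_right_comm]

theorem f_toggle_add_one (h : G.IsStrandPairing Q.state e (Q.state e)) :
    (Q.toggle e).f + 1 = Q.f := by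
  rw [f_add_one_eq_of_isStrandPairing (isStrandPairing_state_toggle h) (Q.state_toggle_ne e),
    cut_state_toggle, f_eq_circles_add, h.circles_eq]

theorem f_toggle_eq (h : G.IsStrandPairing Q.state e t₀) (hQ : Q.state e ≠ t₀)
    (hQ' : (Q.toggle e).state e ≠ t₀) : (Q.toggle e).f = Q.f := by
  rw [← Nat.add_right_cancel_iff (n := 1), f_add_one_eq_of_isStrandPairing h hQ,
    f_add_one_eq_of_isStrandPairing (isStrandPairing_state_toggle h) hQ', cut_state_toggle]

theorem f_le_f_toggle_add_one (Q : G.SpanningSubgraph) (e : E) : Q.f ≤ (Q.toggle e).f + 1 := by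
  obtain ⟨t₀, h⟩ := Q.exists_isStrandPairing_state e
  by_cases hQ : Q.state e = t₀
  · exact (f_toggle_add_one (hQ ▸ h)).ge
  by_cases hQ' : (Q.toggle e).state e = t₀
  · have := f_toggle_add_one (hQ' ▸ isStrandPairing_state_toggle h)
    rw [toggle_toggle] at this
    lia
  · exact (f_toggle_eq h hQ hQ').ge.trans (Nat.le_succ _)

theorem f_toggle_add_one_of_boundaryAt_ne (hx : x.1.1 = e) (hy : y.1.1 = e)
    (hxy : Q.boundaryAt x ≠ Q.boundaryAt y) : (Q.toggle e).f + 1 = Q.f := by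
  obtain ⟨t₀, h⟩ := Q.exists_isStrandPairing_state e
  have hQ : Q.state e = t₀ := by
    by_contra hQ
    exact hxy (boundaryAt_eq_iff.2 (h.circleAt_eq_of_ne (Q.state_ne_zero e) hQ hx hy))
  exact f_toggle_add_one (hQ ▸ h)

theorem f_symmDiff_le (A B : Finset E) :
    (⟨symmDiff A B⟩ : G.SpanningSubgraph).f ≤ (⟨A⟩ : G.SpanningSubgraph).f + B.card := by
  induction B using Finset.induction_on with
  | empty => simp [← Finset.bot_eq_empty]
  | insert e B he ih =>
    have hAB : (⟨symmDiff A (insert e B)⟩ : G.SpanningSubgraph).toggle e = ⟨symmDiff A B⟩ := by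
      ext i
      by_cases hi : i = e <;> simp_all [mem_toggle_iff, Finset.mem_symmDiff]
    have := f_le_f_toggle_add_one (⟨symmDiff A (insert e B)⟩ : G.SpanningSubgraph) e
    rw [hAB] at this
    rw [Finset.card_insert_of_notMem he]
    lia

-- If no exchange of `u` works, then each other edge of `X ∆ Y` has all its corners on a single
-- boundary component of `X ∆ {u}`, so passing from `X ∆ {u}` to `Y` cannot lower `f`.
theorem exists_f_symmDiff_pair_eq {X Y : Finset E} {n : ℕ}
    (hn : ∀ Q : G.SpanningSubgraph, n ≤ Q.f) (hX : (⟨X⟩ : G.SpanningSubgraph).f = n)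
    (hY : (⟨Y⟩ : G.SpanningSubgraph).f = n) {u : E} (hu : u ∈ symmDiff X Y) :
    ∃ v ∈ symmDiff X Y, (⟨symmDiff X {u, v}⟩ : G.SpanningSubgraph).f = n := by
  by_contra! hne
  set Z : G.SpanningSubgraph := toggle ⟨X⟩ u with hZ
  have hZn : n < Z.f := by
    have := hne u hu
    rw [Finset.pair_eq_singleton] at this
    exact (hn Z).lt_of_ne' this
  have hZX : Z.f ≤ n + 1 := by
    have := f_le_f_toggle_add_one Z u
    rwa [hZ, toggle_toggle, hX] at this
  suffices Z.f ≤ (⟨Y⟩ : G.SpanningSubgraph).f by lia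
  refine f_le_f_of_boundaryAt_eq fun x y hxy hx => ?_
  by_contra hbd
  have ⟨hxu, hxXY⟩ : x.1.1 ≠ u ∧ x.1.1 ∈ symmDiff X Y := by
    simp only [hZ, mem_toggle_iff, Finset.mem_symmDiff] at hx hu ⊢
    grind
  have hexch : Z.toggle x.1.1 = ⟨symmDiff X {u, x.1.1}⟩ := by
    ext i
    simp only [hZ, mem_toggle_iff, Finset.mem_symmDiff, Finset.mem_insert, Finset.mem_singleton]
    grind
  have hexch_f := f_toggle_add_one_of_boundaryAt_ne rfl hxy.symm hbd
  rw [hexch] at hexch_f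
  exact hne _ hxXY (by lia)

end Toggle

/-! ## Connected components -/

/-- The connected component of the vertex `v`. -/
abbrev componentAt (Q : G.SpanningSubgraph) (v : V) : Q.Component := Quot.mk _ v

theorem componentAt_eq_of_boundaryAt_eq (h : Q.boundaryAt x = Q.boundaryAt y) :
    Q.componentAt (G.vert x.1) = Q.componentAt (G.vert y.1) :=
  congrArg BoundaryComponent.component h

theorem componentAt_eq_of_subset {Q' : G.SpanningSubgraph} (h : Q.edges ⊆ Q'.edges) {u w : V}
    (huw : Q.componentAt u = Q.componentAt w) : Q'.componentAt u = Q'.componentAt w :=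
  quot_apply_eq_of_mk_eq (fun _ _ ⟨e, he, hu, hw⟩ => Quot.sound ⟨e, h he, hu, hw⟩) huw

theorem component_surjective (Q : G.SpanningSubgraph) :
    Function.Surjective (BoundaryComponent.component : Q.BoundaryComponent → Q.Component) := by
  rintro ⟨v⟩
  by_cases hv : ∀ h, G.vert h ≠ v
  · exact ⟨Sum.inr ⟨v, hv⟩, rfl⟩
  · push Not at hv
    obtain ⟨h, rfl⟩ := hv
    exact ⟨Q.boundaryAt (h, false), rfl⟩

instance [Finite V] (Q : G.SpanningSubgraph) : Finite Q.Component :=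
  inferInstanceAs (Finite (Quot Q.Joined))

instance [Finite V] [Finite E] (Q : G.SpanningSubgraph) : Finite Q.BoundaryComponent :=
  inferInstanceAs (Finite (Quot Q.BoundaryStep ⊕ {v : V // ∀ h, G.vert h ≠ v}))

theorem k_le_f [Finite V] [Finite E] (Q : G.SpanningSubgraph) : Q.k ≤ Q.f :=
  Nat.card_le_card_of_surjective _ Q.component_surjective

theorem apply_eq_of_vert_eq {R : Type*} {g : Corner E → R} (harc : ∀ x, g (G.arcEnd x) = g x)
    (hsegment : ∀ h, g (h, true) = g (h, false)) (hxy : G.vert x.1 = G.vert y.1) : g x = g y := by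
  have hrot (h) : g (G.rot h, false) = g (h, false) := (harc (h, true)).trans (hsegment h)
  have hzpow (h) (n : ℤ) : g ((G.rot ^ n) h, false) = g (h, false) := by
    induction n with
    | zero => rfl
    | succ n ih => rw [add_comm, zpow_one_add, Equiv.Perm.mul_apply, hrot, ih]
    | pred n ih =>
      rw [← ih, ← hrot, ← Equiv.Perm.mul_apply, ← zpow_one_add, add_sub_cancel]
  have hfalse (z : Corner E) : g z = g (z.1, false) := by
    obtain ⟨h, _ | _⟩ := z
    exacts [rfl, hsegment h]
  obtain ⟨n, hn⟩ := G.sameCycle_of_vert_eq _ _ hxy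
  rw [hfalse x, hfalse y, ← hn, hzpow]

theorem exists_comp_component_eq {R : Type*} (g : Q.BoundaryComponent → R)
    (hg : ∀ e ∈ Q.edges,
      g (Q.boundaryAt ((e, false), false)) = g (Q.boundaryAt ((e, false), true))) :
    ∃ g' : Q.Component → R, ∀ b, g' b.component = g b := by
  have hside (e) (he : e ∈ Q.edges) (b s) :
      Q.boundaryAt ((e, b), s) = Q.boundaryAt ((e, !b), xor s (!G.twisted e)) :=
    congrArg Sum.inl (Quot.sound (BoundaryStep.side e he b s))
  have harc (x) : g (Q.boundaryAt (G.arcEnd x)) = g (Q.boundaryAt x) :=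
    congrArg g (boundaryAt_eq_iff.2 circleAt_arcEnd)
  have hsegment : ∀ h, g (Q.boundaryAt (h, true)) = g (Q.boundaryAt (h, false)) := by
    rintro ⟨e, b⟩
    by_cases he : e ∈ Q.edges
    · cases b
      · exact (hg e he).symm
      · rw [hside e he true false, hside e he true true]
        cases G.twisted e
        exacts [hg e he, (hg e he).symm]
    · exact congrArg (g ∘ Sum.inl) (Quot.sound (BoundaryStep.segment e he b)).symm
  have hvert (v : V) : ∃ r, (∀ x : Corner E, G.vert x.1 = v → g (Q.boundaryAt x) = r) ∧
      ∀ hv, g (Sum.inr ⟨v, hv⟩) = r := by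
    by_cases hv : ∀ h, G.vert h ≠ v
    · exact ⟨g (Sum.inr ⟨v, hv⟩), fun x hx => absurd hx (hv x.1), fun _ => rfl⟩
    · push Not at hv
      obtain ⟨h, rfl⟩ := hv
      exact ⟨g (Q.boundaryAt (h, false)),
        fun x hx => apply_eq_of_vert_eq (g := g ∘ Q.boundaryAt) harc hsegment hx,
        fun hv => absurd rfl (hv h)⟩
  choose g₀ hcorner hisolated using hvert
  refine ⟨Quot.lift g₀ ?_, ?_⟩
  · rintro _ _ ⟨e, he, rfl, rfl⟩
    rw [← hcorner _ ((e, false), false) rfl, hside e he, hcorner _ _ rfl, Bool.not_false]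
  · rintro (x | ⟨v, hv⟩)
    · induction x using Quot.ind with
      | mk x => exact (hcorner _ x rfl).symm
    · exact (hisolated v hv).symm

theorem f_eq_k_of_boundaryAt_eq [Finite V] [Finite E] (h : ∀ e ∈ Q.edges,
    Q.boundaryAt ((e, false), false) = Q.boundaryAt ((e, false), true)) : Q.f = Q.k := by
  obtain ⟨g, hg⟩ := exists_comp_component_eq id h
  have hinj : Function.Injective (BoundaryComponent.component (Q := Q)) :=
    Function.LeftInverse.injective hg
  exact (Nat.card_le_card_of_injective _ hinj).antisymm Q.k_le_f

theorem k_le_k_of_subset [Finite V] {Q' : G.SpanningSubgraph} (h : Q.edges ⊆ Q'.edges) :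
    Q'.k ≤ Q.k :=
  card_quot_le_card_quot fun _ _ ⟨e, he, hu, hw⟩ => Quot.sound ⟨e, h he, hu, hw⟩

theorem k_empty [Fintype V] : (⟨∅⟩ : G.SpanningSubgraph).k = G.v := by
  refine (Nat.card_congr (Equiv.ofBijective (Quot.mk _) ⟨?_, Quot.mk_surjective⟩)).symm.trans
    Nat.card_eq_fintype_card
  intro u w huw
  exact quot_apply_eq_of_mk_eq (g := id) (fun _ _ ⟨e, he, _⟩ => absurd he (Finset.notMem_empty e))
    huw

theorem k_insert_add_one [Finite V] [DecidableEq E]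
    (h : Q.componentAt (G.vert (e, false)) ≠ Q.componentAt (G.vert (e, true))) :
    (⟨insert e Q.edges⟩ : G.SpanningSubgraph).k + 1 = Q.k := by
  refine card_quot_add_one (a := G.vert (e, false)) (b := G.vert (e, true)) ?_ ?_ ?_ h
  · rintro _ _ ⟨i, hi, rfl, rfl⟩
    exact Quot.sound ⟨i, Finset.mem_insert_of_mem hi, rfl, rfl⟩
  · exact Quot.sound ⟨e, Finset.mem_insert_self e _, rfl, rfl⟩
  · rintro _ _ ⟨i, hi, rfl, rfl⟩
    rcases Finset.mem_insert.1 hi with rfl | hi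
    exacts [Or.inr rfl, Or.inl (Quot.sound ⟨i, hi, rfl, rfl⟩)]

theorem k_insert [Finite V] [DecidableEq E]
    (h : Q.componentAt (G.vert (e, false)) = Q.componentAt (G.vert (e, true))) :
    (⟨insert e Q.edges⟩ : G.SpanningSubgraph).k = Q.k := by
  refine (k_le_k_of_subset (Finset.subset_insert e _)).antisymm (card_quot_le_card_quot ?_)
  rintro _ _ ⟨i, hi, rfl, rfl⟩
  rcases Finset.mem_insert.1 hi with rfl | hi
  exacts [h, Quot.sound ⟨i, hi, rfl, rfl⟩]

theorem k_whole_le [Finite V] [Fintype E] (Q : G.SpanningSubgraph) : G.k ≤ Q.k :=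
  k_le_k_of_subset (Finset.subset_univ _)

theorem k_whole_le_f [Finite V] [Fintype E] (Q : G.SpanningSubgraph) : G.k ≤ Q.f :=
  Q.k_whole_le.trans Q.k_le_f

theorem isQuasiTree_iff_f_eq [Finite V] [Fintype E] (Q : G.SpanningSubgraph) :
    Q.IsQuasiTree ↔ Q.f = G.k := by
  rw [IsQuasiTree, ← Function.bijective_iff_existsUnique]
  constructor
  · rintro ⟨hk, hcomponent⟩
    exact (Nat.card_eq_of_bijective _ hcomponent).trans hk
  · intro hf
    have hk : Q.k = G.k := (Q.k_le_f.trans hf.le).antisymm Q.k_whole_le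
    exact ⟨hk, Q.component_surjective.bijective_of_nat_card_le (hf.trans hk.symm).le⟩

/-! ## Orientability -/

theorem state_eq_or_eq_toggle [DecidableEq E] (P Q : G.SpanningSubgraph) (e : E) :
    P.state e = Q.state e ∨ P.state e = (Q.toggle e).state e := by
  by_cases h : e ∈ P.edges ↔ e ∈ Q.edges
  · exact Or.inl (state_congr h)
  · exact Or.inr (state_congr (by simp only [mem_toggle_iff, ne_eq, not_true]; tauto))

theorem orientable_iff_exists_isAlternating :
    G.Orientable ↔ ∃ c, ∀ Q : G.SpanningSubgraph, G.IsAlternating Q.state c := by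
  constructor
  · rintro ⟨o, ho⟩
    refine ⟨fun x => xor x.2 (o (G.vert x.1)), fun Q => ⟨?_, ?_⟩⟩
    · intro x
      rw [G.arcEnd_snd, G.vert_arcEnd, Bool.not_xor]
    · rintro ⟨⟨e, b⟩, s⟩ -
      by_cases he : e ∈ Q.edges
      · rw [pairing_state_of_mem he, ho e]
        cases b <;> simp [Bool.xor_comm, Bool.xor_left_comm]
      · simp [pairing_state_of_notMem he]
  · rintro ⟨c, hc⟩
    have hsegment (h) : c (h, true) = !c (h, false) := by
      have := (hc ⟨∅⟩).apply_pairing (h, false) (state_ne_zero _ _)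
      rwa [pairing_state_of_notMem (Finset.notMem_empty _)] at this
    have hvert : (fun x : Corner E => xor x.2 (c x)).FactorsThrough fun x => G.vert x.1 :=
      fun x y hxy => apply_eq_of_vert_eq (g := fun x : Corner E => xor x.2 (c x))
        (fun x => by simp [(hc ⟨∅⟩).apply_arcEnd, G.arcEnd_snd]) (fun h => by simp [hsegment]) hxy
    let o : V → Bool :=
      Function.extend (fun x : Corner E => G.vert x.1) (fun x => xor x.2 (c x)) fun _ => false
    have ho (h) : o (G.vert h) = c (h, false) :=
      (hvert.extend_apply _ (h, false)).trans (Bool.false_xor _)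
    refine ⟨o, fun e => ?_⟩
    have hside := (hc ⟨{e}⟩).apply_pairing ((e, false), false) (state_ne_zero _ _)
    rw [pairing_state_of_mem (Finset.mem_singleton_self e)] at hside
    rw [ho, ho]
    cases htwist : G.twisted e <;> simp_all

theorem even_f_toggle_iff [DecidableEq E] [Finite V] [Finite E] (hG : G.Orientable)
    (Q : G.SpanningSubgraph) (e : E) : Even (Q.toggle e).f ↔ ¬ Even Q.f := by
  obtain ⟨c, hc⟩ := orientable_iff_exists_isAlternating.1 hG
  obtain ⟨t₀, h⟩ := Q.exists_isStrandPairing_state e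
  have h' := isStrandPairing_state_toggle h
  by_cases hQ : Q.state e = t₀
  · have := f_toggle_add_one (hQ ▸ h)
    rw [← this, Nat.even_add_one, not_not]
  by_cases hQ' : (Q.toggle e).state e = t₀
  · have := f_toggle_add_one (hQ' ▸ h')
    rw [toggle_toggle] at this
    rw [← this, Nat.even_add_one]
  -- Now `t₀` is the sum of the two states at `e`, and each of the three reverses the colours.
  exfalso
  set x : Corner E := ((e, false), false)
  have hsum : Q.state e + (Q.toggle e).state e = t₀ :=
    klein_add_eq_of_ne (Q.state_ne_zero e) (state_ne_zero _ e) h.ne_zero (Q.state_toggle_ne e).symm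
      hQ hQ'
  have hstrand : c (shift t₀ x) = !c x :=
    ((hc Q).isAlternating_cut e).apply_shift_of_circleAt_eq h.ne_zero rfl
      ((h.circleAt_shift_eq_iff x rfl t₀).2 (Or.inr rfl))
  have hpairing : c (shift ((Q.toggle e).state e) (shift (Q.state e) x)) = !c (pairing Q.state x) :=
    (hc (Q.toggle e)).apply_pairing _ (state_ne_zero _ _)
  rw [shift_shift, hsum, hstrand, (hc Q).apply_pairing x (state_ne_zero _ _)] at hpairing
  simp at hpairing

theorem even_f_add_card_iff [Finite V] [Finite E] (hG : G.Orientable)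
    (A : Finset E) :
    Even ((⟨A⟩ : G.SpanningSubgraph).f + A.card) ↔ Even (⟨∅⟩ : G.SpanningSubgraph).f := by
  classical
  induction A using Finset.induction_on with
  | empty => rw [Finset.card_empty, add_zero]
  | insert e A he ih =>
    have := even_f_toggle_iff hG ⟨A⟩ e
    rw [toggle_of_notMem he] at this
    rw [← ih, Finset.card_insert_of_notMem he, ← add_assoc, Nat.even_add_one, Nat.even_add,
      Nat.even_add, this]
    tauto

theorem orientable_of_forall_f_lt_f_toggle [DecidableEq E] [Finite V] [Finite E]
    (hQ : ∀ e, Q.f < (Q.toggle e).f) : G.Orientable := by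
  obtain ⟨c, hc⟩ := exists_isAlternating G Q.state
  refine orientable_iff_exists_isAlternating.2 ⟨c, fun P => ⟨hc.apply_arcEnd, fun x _ => ?_⟩⟩
  rcases state_eq_or_eq_toggle P Q x.1.1 with hP | hP
  · rw [pairing, hP]
    exact hc.apply_pairing x (Q.state_ne_zero _)
  · obtain ⟨t₀, h⟩ := Q.exists_isStrandPairing_state x.1.1
    have htoggle : (Q.toggle x.1.1).state x.1.1 = t₀ := by
      by_contra hQ'
      by_cases hQ₀ : Q.state x.1.1 = t₀
      · exact (hQ x.1.1).not_gt ((f_toggle_add_one (hQ₀ ▸ h)) ▸ Nat.lt_succ_self _)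
      · exact (hQ x.1.1).ne' (f_toggle_eq h hQ₀ hQ')
    rw [pairing, hP, htoggle]
    exact (hc.isAlternating_cut x.1.1).apply_shift_of_circleAt_eq h.ne_zero rfl
      ((h.circleAt_shift_eq_iff x rfl t₀).2 (Or.inr rfl))

/-! ## The Euler genus -/

/-- The incidence matrix over `ℤ/2ℤ`; loops have a zero column. -/
def incidence [DecidableEq V] (Q : G.SpanningSubgraph) : Matrix V Q.edges (ZMod 2) :=
  fun v e => (if G.vert (e.1, false) = v then 1 else 0) + (if G.vert (e.1, true) = v then 1 else 0)

theorem boundaryOne_eq_mulVecLin [DecidableEq V] (Q : G.SpanningSubgraph) :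
    Q.boundaryOne = Q.incidence.mulVecLin := by
  ext x v
  simp [boundaryOne, incidence, Matrix.mulVec, dotProduct, Pi.single_apply, add_mul, eq_comm]

theorem incidence_transpose_mulVecLin_apply [Fintype V] [DecidableEq V] (g : V → ZMod 2)
    (e : Q.edges) :
    Q.incidence.transpose.mulVecLin g e = g (G.vert (e.1, false)) + g (G.vert (e.1, true)) := by
  simp [incidence, Matrix.vecMul, dotProduct, mul_add, Finset.sum_add_distrib]

theorem ker_incidence_transpose [Fintype V] [DecidableEq V] (Q : G.SpanningSubgraph) :
    LinearMap.ker Q.incidence.transpose.mulVecLin =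
      LinearMap.range (LinearMap.funLeft (ZMod 2) (ZMod 2) Q.componentAt) := by
  ext g
  rw [LinearMap.mem_ker, LinearMap.mem_range]
  constructor
  · intro hg
    refine ⟨Quot.lift g ?_, rfl⟩
    rintro _ _ ⟨e, he, rfl, rfl⟩
    rw [← CharTwo.add_eq_zero, ← incidence_transpose_mulVecLin_apply g ⟨e, he⟩, hg, Pi.zero_apply]
  · rintro ⟨g, rfl⟩
    funext e
    rw [incidence_transpose_mulVecLin_apply]
    exact CharTwo.add_eq_zero.2 (congrArg g (Quot.sound ⟨e.1, e.2, rfl, rfl⟩))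

theorem finrank_range_boundaryOne_add_k [Fintype V] [DecidableEq V] (Q : G.SpanningSubgraph) :
    Module.finrank (ZMod 2) (LinearMap.range Q.boundaryOne) + Q.k = G.v := by
  have := Fintype.ofFinite Q.Component
  have hsurj : Function.Surjective Q.componentAt := Quot.mk_surjective
  have hrank := LinearMap.finrank_range_add_finrank_ker Q.incidence.transpose.mulVecLin
  rw [ker_incidence_transpose, LinearMap.finrank_range_of_inj
    (LinearMap.funLeft_injective_of_surjective _ _ _ hsurj), Module.finrank_pi,
    Module.finrank_pi, ← Nat.card_eq_fintype_card (α := Q.Component)] at hrank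
  refine Eq.trans ?_ hrank
  rw [boundaryOne_eq_mulVecLin]
  exact congrArg (· + Q.k) (Matrix.rank_transpose Q.incidence).symm

theorem ker_boundaryTwo (Q : G.SpanningSubgraph) :
    LinearMap.ker Q.boundaryTwo =
      LinearMap.range (LinearMap.funLeft (ZMod 2) (ZMod 2)
        (BoundaryComponent.component : Q.BoundaryComponent → Q.Component)) := by
  ext g
  rw [LinearMap.mem_ker, LinearMap.mem_range]
  constructor
  · intro hg
    obtain ⟨g', hg'⟩ := exists_comp_component_eq g fun e he =>
      CharTwo.add_eq_zero.1 (congrFun hg ⟨e, he⟩)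
    exact ⟨g', funext hg'⟩
  · rintro ⟨g, rfl⟩
    funext e
    exact CharTwo.add_eq_zero.2 rfl

theorem finrank_range_boundaryTwo_add_k [Finite V] [Finite E] (Q : G.SpanningSubgraph) :
    Module.finrank (ZMod 2) (LinearMap.range Q.boundaryTwo) + Q.k = Q.f := by
  have := Fintype.ofFinite Q.Component
  have := Fintype.ofFinite Q.BoundaryComponent
  have hrank := LinearMap.finrank_range_add_finrank_ker Q.boundaryTwo
  rwa [ker_boundaryTwo, LinearMap.finrank_range_of_inj
    (LinearMap.funLeft_injective_of_surjective _ _ _ Q.component_surjective), Module.finrank_pi,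
    Module.finrank_pi, ← Nat.card_eq_fintype_card, ← Nat.card_eq_fintype_card] at hrank

theorem eulerGenus_add_v_add_f [Fintype V] [DecidableEq V] [Finite E] (Q : G.SpanningSubgraph) :
    Q.eulerGenus + G.v + Q.f = Q.edges.card + 2 * Q.k := by
  have := Fintype.ofFinite E
  have hker := LinearMap.finrank_range_add_finrank_ker Q.boundaryOne
  rw [Module.finrank_pi, Fintype.card_coe] at hker
  have hhomology := Submodule.finrank_quotient_add_finrank
    ((LinearMap.range Q.boundaryTwo).comap (LinearMap.ker Q.boundaryOne).subtype)
  have hle : LinearMap.range Q.boundaryTwo ≤ LinearMap.ker Q.boundaryOne :=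
    LinearMap.range_le_iff_comap.2 (Submodule.eq_top_iff'.2 Q.boundaryOne_boundaryTwo)
  rw [(Submodule.comapSubtypeEquivOfLe hle).finrank_eq, ← eulerGenus] at hhomology
  have := Q.finrank_range_boundaryOne_add_k
  have := Q.finrank_range_boundaryTwo_add_k
  lia

theorem v_le_card_add_k [Fintype V] [Finite E] (Q : G.SpanningSubgraph) :
    G.v ≤ Q.edges.card + Q.k := by
  classical
  have := Q.eulerGenus_add_v_add_f
  have := Q.k_le_f
  lia

/-! ## Forests and quasi-trees -/

section Forest

variable [DecidableEq E]

theorem isForest_iff [Finite V] : Q.IsForest ↔ ∀ e ∈ Q.edges,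
    (⟨Q.edges.erase e⟩ : G.SpanningSubgraph).componentAt (G.vert (e, false)) ≠
      (⟨Q.edges.erase e⟩ : G.SpanningSubgraph).componentAt (G.vert (e, true)) := by
  refine forall₂_congr fun e he => ⟨fun hlt heq => ?_, fun hne => ?_⟩
  · have := k_insert heq
    rw [Finset.insert_erase he] at this
    exact hlt.ne this
  · have := k_insert_add_one hne
    rw [Finset.insert_erase he] at this
    exact this ▸ Nat.lt_succ_self _

theorem IsForest.mono [Finite V] {P : G.SpanningSubgraph} (hQ : Q.IsForest)
    (hPQ : P.edges ⊆ Q.edges) : P.IsForest :=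
  isForest_iff.2 fun e he h => isForest_iff.1 hQ e (hPQ he)
    (componentAt_eq_of_subset (Finset.erase_subset_erase e hPQ) h)

theorem IsForest.card_add_k [Fintype V] (hQ : Q.IsForest) : Q.edges.card + Q.k = G.v := by
  obtain ⟨A⟩ := Q
  induction A using Finset.induction_on with
  | empty => rw [Finset.card_empty, zero_add, k_empty]
  | insert e A he ih =>
    have hne := isForest_iff.1 hQ e (Finset.mem_insert_self e A)
    rw [Finset.erase_insert he] at hne
    rw [Finset.card_insert_of_notMem he, ← ih (hQ.mono (Finset.subset_insert e A)),
      ← k_insert_add_one hne, add_right_comm, add_assoc]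

theorem isForest_of_card_add_k [Fintype V] [Finite E] (hQ : Q.edges.card + Q.k = G.v) :
    Q.IsForest := by
  intro e he
  have := v_le_card_add_k (⟨Q.edges.erase e⟩ : G.SpanningSubgraph)
  have := Finset.card_erase_add_one he
  dsimp only at *
  lia

theorem exists_isMaximalForest [Finite E] (G : RibbonGraph V E) :
    ∃ T : G.SpanningSubgraph, T.IsMaximalForest := by
  obtain ⟨T, hT⟩ :=
    (Set.toFinite {A : Finset E | (⟨A⟩ : G.SpanningSubgraph).IsForest}).exists_maximal
      ⟨∅, fun e he => absurd he (Finset.notMem_empty e)⟩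
  exact ⟨⟨T⟩, hT.1, fun Q hQ h => SpanningSubgraph.ext (hT.eq_of_ge hQ h)⟩

theorem IsMaximalForest.k_eq [Finite V] [Fintype E] {T : G.SpanningSubgraph}
    (hT : T.IsMaximalForest) : T.k = G.k := by
  have := Fintype.ofFinite V
  refine (card_quot_le_card_quot ?_).antisymm T.k_whole_le
  rintro _ _ ⟨e, -, rfl, rfl⟩
  by_contra hne
  have he : e ∉ T.edges := fun he => hne (Quot.sound ⟨e, he, rfl, rfl⟩)
  have hforest : (⟨insert e T.edges⟩ : G.SpanningSubgraph).IsForest := by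
    refine isForest_of_card_add_k ?_
    rw [Finset.card_insert_of_notMem he, ← hT.1.card_add_k, ← k_insert_add_one hne,
      add_right_comm, add_assoc]
  have hinsert := congrArg edges (hT.2 _ hforest (Finset.subset_insert e T.edges))
  exact he (hinsert ▸ Finset.mem_insert_self e T.edges)

theorem IsMaximalForest.card_add_k [Fintype V] [Fintype E] {T : G.SpanningSubgraph}
    (hT : T.IsMaximalForest) : T.edges.card + G.k = G.v := by
  rw [← hT.k_eq, hT.1.card_add_k]

theorem IsMaximalForest.f_eq [Finite V] [Fintype E] {T : G.SpanningSubgraph}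
    (hT : T.IsMaximalForest) : T.f = G.k := by
  classical
  have := Fintype.ofFinite V
  have := T.eulerGenus_add_v_add_f
  have := hT.card_add_k
  have := hT.k_eq
  have := T.k_le_f
  lia

theorem k_toggle_eq_of_boundaryAt_ne [Finite V] [Finite E] (he : e ∈ Q.edges)
    (hne : Q.boundaryAt ((e, false), false) ≠ Q.boundaryAt ((e, false), true)) :
    (Q.toggle e).k = Q.k := by
  have hdown : (Q.toggle e).f + 1 = Q.f := f_toggle_add_one_of_boundaryAt_ne rfl rfl hne
  have hends : (Q.toggle e).boundaryAt ((e, false), false) =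
      (Q.toggle e).boundaryAt ((e, true), false) := by
    by_contra hends
    have := f_toggle_add_one_of_boundaryAt_ne (Q := Q.toggle e) (e := e)
      (x := ((e, false), false)) (y := ((e, true), false)) rfl rfl hends
    rw [toggle_toggle] at this
    lia
  have hk := k_insert (componentAt_eq_of_boundaryAt_eq hends)
  rw [← hk, toggle_of_mem he, Finset.insert_erase he]

end Forest

-- Deleting an edge that meets two boundary components merges them and disconnects nothing.
theorem exists_subset_f_eq [Finite V] [Fintype E] (hQ : Q.k = G.k) :
    ∃ F ⊆ Q.edges, (⟨F⟩ : G.SpanningSubgraph).f = G.k ∧ F.card + Q.f = Q.edges.card + G.k := by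
  classical
  obtain ⟨A⟩ := Q
  induction A using Finset.strongInduction with | H A ih =>
  by_cases hf : (⟨A⟩ : G.SpanningSubgraph).f = G.k
  · exact ⟨A, subset_rfl, hf, by rw [hf]⟩
  obtain ⟨e, he, hne⟩ : ∃ e ∈ A,
      (⟨A⟩ : G.SpanningSubgraph).boundaryAt ((e, false), false) ≠
        (⟨A⟩ : G.SpanningSubgraph).boundaryAt ((e, false), true) := by
    by_contra! h
    exact hf ((f_eq_k_of_boundaryAt_eq h).trans hQ)
  have hk := k_toggle_eq_of_boundaryAt_ne he hne
  have hf' : (toggle ⟨A⟩ e : G.SpanningSubgraph).f + 1 = (⟨A⟩ : G.SpanningSubgraph).f :=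
    f_toggle_add_one_of_boundaryAt_ne rfl rfl hne
  rw [toggle_of_mem he] at hk hf'
  obtain ⟨F, hFA, hF, hcard⟩ := ih _ (Finset.erase_ssubset he) (hk.trans hQ)
  have := Finset.card_erase_add_one he
  exact ⟨F, hFA.trans (Finset.erase_subset e A), hF, by dsimp only at *; lia⟩

theorem IsQuasiTree.eulerGenus_add_v [Fintype V] [DecidableEq V] [Fintype E]
    (hQ : Q.IsQuasiTree) : Q.eulerGenus + G.v = Q.edges.card + G.k := by
  have := Q.eulerGenus_add_v_add_f
  have := Q.isQuasiTree_iff_f_eq.1 hQ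
  have : Q.k = G.k := hQ.1
  lia

theorem even_card_edges_toggle_iff [DecidableEq E] (Q : G.SpanningSubgraph) (e : E) :
    Even (Q.toggle e).edges.card ↔ ¬ Even Q.edges.card := by
  by_cases he : e ∈ Q.edges
  · rw [toggle_of_mem he, ← Finset.card_erase_add_one he, Nat.even_add_one, not_not]
  · rw [toggle_of_notMem he, Finset.card_insert_of_notMem he, Nat.even_add_one]

end RibbonGraph.SpanningSubgraph

/-! ## The delta-matroid of a ribbon graph -/

namespace SetSystem

variable {E : Type*} {M : SetSystem E} {F : Finset E}

theorem rank_eq_of_forall_card_eq (hF : F ∈ M.feasible)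
    (h : ∀ F' ∈ M.feasible, F'.card = F.card) : M.rank = F.card := by
  have himage : Finset.card '' M.feasible = {F.card} :=
    Set.eq_singleton_iff_unique_mem.2 ⟨Set.mem_image_of_mem _ hF, Set.forall_mem_image.2 h⟩
  rw [rank, himage, csSup_singleton]

theorem rank_lower_eq_card (hF : F ∈ M.lower.feasible) : M.lower.rank = F.card :=
  rank_eq_of_forall_card_eq hF fun F' hF' => (hF'.2 F hF.1).antisymm (hF.2 F' hF'.1)

theorem rank_upper_eq_card (hF : F ∈ M.upper.feasible) : M.upper.rank = F.card :=
  rank_eq_of_forall_card_eq hF fun F' hF' => (hF.2 F' hF'.1).antisymm (hF'.2 F hF.1)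

end SetSystem

namespace RibbonGraph

open SpanningSubgraph

section Finite

variable {V E : Type*} [Finite V] [Fintype E] {G : RibbonGraph V E}

theorem mem_feasible_deltaMatroid_iff {F : Finset E} :
    F ∈ G.deltaMatroid.feasible ↔ (⟨F⟩ : G.SpanningSubgraph).f = G.k := by
  rw [← isQuasiTree_iff_f_eq]
  exact ⟨fun ⟨_, hQ, hF⟩ => hF ▸ hQ, fun hF => ⟨⟨F⟩, hF, rfl⟩⟩

theorem SpanningSubgraph.IsMaximalForest.edges_mem_feasible [DecidableEq E]
    {T : G.SpanningSubgraph} (hT : T.IsMaximalForest) : T.edges ∈ G.deltaMatroid.feasible :=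
  mem_feasible_deltaMatroid_iff.2 hT.f_eq

theorem SpanningSubgraph.IsMaximalForest.rank_lower_eq_card [DecidableEq E]
    {T : G.SpanningSubgraph} (hT : T.IsMaximalForest) :
    G.deltaMatroid.lower.rank = T.edges.card := by
  have := Fintype.ofFinite V
  refine SetSystem.rank_lower_eq_card ⟨hT.edges_mem_feasible, ?_⟩
  rintro _ ⟨Q, hQ, rfl⟩
  have := hT.card_add_k
  have := Q.v_le_card_add_k
  have : Q.k = G.k := hQ.1
  lia

theorem isDeltaMatroid_deltaMatroid [DecidableEq E] (G : RibbonGraph V E) :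
    G.deltaMatroid.IsDeltaMatroid := by
  obtain ⟨T, hT⟩ := exists_isMaximalForest G
  refine ⟨⟨T.edges, hT.edges_mem_feasible⟩, fun X hX Y hY u hu => ?_⟩
  simp only [mem_feasible_deltaMatroid_iff] at hX hY ⊢
  exact exists_f_symmDiff_pair_eq k_whole_le_f hX hY hu

theorem orientable_of_isEven (hG : G.deltaMatroid.IsEven) : G.Orientable := by
  classical
  obtain ⟨T, hT⟩ := exists_isMaximalForest G
  refine orientable_of_forall_f_lt_f_toggle (Q := T) fun e => ?_
  rw [hT.f_eq]
  refine (k_whole_le_f _).lt_of_ne' fun hf => ?_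
  have hparity := hG _ hT.edges_mem_feasible _
    (mem_feasible_deltaMatroid_iff (F := (T.toggle e).edges).2 hf)
  rw [even_card_edges_toggle_iff] at hparity
  exact iff_not_self hparity

theorem Orientable.isEven (hG : G.Orientable) : G.deltaMatroid.IsEven := by
  intro F hF F' hF'
  rw [mem_feasible_deltaMatroid_iff] at hF hF'
  have hparity := (even_f_add_card_iff hG F).trans (even_f_add_card_iff hG F').symm
  rw [hF, hF', Nat.even_add, Nat.even_add] at hparity
  tauto

end Finite

variable {V E : Type*} [Fintype V] [Fintype E] {G : RibbonGraph V E}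

theorem rank_lower_deltaMatroid_add_k (G : RibbonGraph V E) :
    G.deltaMatroid.lower.rank + G.k = G.v := by
  classical
  obtain ⟨T, hT⟩ := exists_isMaximalForest G
  rw [hT.rank_lower_eq_card, hT.card_add_k]

variable [DecidableEq V]

theorem bijOn_edges (G : RibbonGraph V E) (m : ℕ) :
    Set.BijOn (fun Q : G.SpanningSubgraph => Q.edges)
      {Q | Q.IsQuasiTree ∧ (Q.eulerGenus : ℤ) = (m : ℤ) - (G.v : ℤ) + (G.k : ℤ)}
      {F | F ∈ G.deltaMatroid.feasible ∧ F.card = m} := by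
  have hcard {Q : G.SpanningSubgraph} (hQ : Q.IsQuasiTree) :
      (Q.eulerGenus : ℤ) = (m : ℤ) - (G.v : ℤ) + (G.k : ℤ) ↔ Q.edges.card = m := by
    have := hQ.eulerGenus_add_v
    lia
  refine ⟨fun Q hQ => ⟨⟨Q, hQ.1, rfl⟩, (hcard hQ.1).1 hQ.2⟩,
    fun _ _ _ _ => SpanningSubgraph.ext, ?_⟩
  rintro _ ⟨⟨Q, hQ, rfl⟩, hm⟩
  exact ⟨Q, ⟨hQ, (hcard hQ).2 hm⟩, rfl⟩

theorem card_add_k_le_of_mem_feasible {F : Finset E} (hF : F ∈ G.deltaMatroid.feasible) :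
    F.card + G.k ≤ G.eulerGenus + G.v := by
  classical
  have hwhole : G.eulerGenus + G.v + G.whole.f = Fintype.card E + 2 * G.k :=
    G.whole.eulerGenus_add_v_add_f
  have hf : G.whole.f ≤ (⟨F⟩ : G.SpanningSubgraph).f + Fᶜ.card := by
    have := f_symmDiff_le (G := G) F Fᶜ
    rwa [symmDiff_compl_self] at this
  rw [mem_feasible_deltaMatroid_iff.1 hF] at hf
  have := F.card_add_card_compl
  lia

theorem exists_mem_feasible_card_add_k_eq (G : RibbonGraph V E) :
    ∃ F ∈ G.deltaMatroid.feasible, F.card + G.k = G.eulerGenus + G.v := by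
  obtain ⟨F, -, hF, hcard⟩ := exists_subset_f_eq (Q := G.whole) rfl
  have hwhole : G.eulerGenus + G.v + G.whole.f = G.whole.edges.card + 2 * G.k :=
    G.whole.eulerGenus_add_v_add_f
  exact ⟨F, mem_feasible_deltaMatroid_iff.2 hF, by lia⟩

theorem rank_upper_deltaMatroid_add_k (G : RibbonGraph V E) :
    G.deltaMatroid.upper.rank + G.k = G.eulerGenus + G.v := by
  obtain ⟨F, hF, hcard⟩ := G.exists_mem_feasible_card_add_k_eq
  rw [← hcard, SetSystem.rank_upper_eq_card ⟨hF, fun F' hF' => ?_⟩]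
  have := card_add_k_le_of_mem_feasible hF'
  lia

end RibbonGraph

theorem propositionp {V E : Type*} [Fintype V] [DecidableEq V] [Fintype E] [DecidableEq E]
    (G : RibbonGraph V E) :
    G.deltaMatroid.IsDeltaMatroid ∧
    (∀ m : ℕ, Set.BijOn (fun Q : G.SpanningSubgraph => Q.edges)
      {Q | Q.IsQuasiTree ∧ (Q.eulerGenus : ℤ) = (m : ℤ) - (G.v : ℤ) + (G.k : ℤ)}
      {F | F ∈ G.deltaMatroid.feasible ∧ F.card = m}) ∧
    (∀ T : G.SpanningSubgraph, T.IsMaximalForest →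
      G.deltaMatroid.lower.rank = T.edges.card) ∧
    (G.deltaMatroid.lower.rank : ℤ) = (G.v : ℤ) - (G.k : ℤ) ∧
    (G.eulerGenus : ℤ) = G.deltaMatroid.width ∧
    (G.deltaMatroid.IsEven ↔ G.Orientable) := by
  have hlower := G.rank_lower_deltaMatroid_add_k
  have hupper := G.rank_upper_deltaMatroid_add_k
  refine ⟨G.isDeltaMatroid_deltaMatroid, G.bijOn_edges,
    fun _ hT => hT.rank_lower_eq_card, by lia, ?_,
    RibbonGraph.orientable_of_isEven, RibbonGraph.Orientable.isEven⟩
  rw [SetSystem.width]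
  lia
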